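/- Fix integers $k\ge 2$ and $n\ge 1$. An operator of order $k$ is a symbol $[\pi]$, where $\pi$ is a permutation of length $j$, $2\le j\le k$, which is both Baxter and simple (these are the permutations that encode the uniquely $\mathrm{HFO}_j$ floorplans). Here $\pi$ is Baxter if there are no positions $a<b<c<d$ with $\pi(c)<\pi(a)+1=\pi(d)<\pi(b)$ or $\pi(b)<\pi(a)=\pi(d)+1<\pi(c)$, and simple if the only sets of consecutive positions that it maps onto sets of consecutive values are single positions and the set of all positions. The operators of length $2$, namely $[12]$ and $[21]$, are called slicing, and those of length $5$ are called wheels. For a word $w$ in the operands $1,\dots,n$ and the operators of order $k$ let $y(w)$ be its number of operands and $x(w)$ the sum of $j-1$ over its operators, $j$ being the length of the operator. The word $w$ is complete if $x(w')<y(w')$ for every nonempty prefix $w'$ of $w$, and $x(w)+1=y(w)$; that is, if it is the post-order traversal of a single tree. A normalized Polish expression of order $k$ with $n$ operands is a complete word in which each of $1,\dots,n$ occurs exactly once and in which neither $[12][12]$ nor $[21][21]$ occurs as two consecutive elements. The moves are the following replacements within a word; the operators mentioned are of order $k$. * M1: (a) exchange two operands that have only operators (possibly none) between them; (b) exchange an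 operand and an operator that are adjacent, in either order; (c) exchange two adjacent operators, at most one of which is slicing. * M2: (a) exchange $[12]$ and $[21]$ throughout a maximal nonempty run of consecutive slicing operators; (b) replace an operator by another operator of the same length. * M3: replace a complete subword $E_1X_1E_2X_2\cdots E_jX_j$, where $E_1,\dots,E_j$ are complete words, $X_1,\dots,X_j$ are (possibly empty) words of operators and $X_1X_2\cdots X_j$ is not a single operator of length $j$, by $E_1E_2\cdots E_j[\pi]$, where $[\pi]$ is an operator of length $j$. * M4: replace a wheel by a word of four alternating slicing operators, or replace an operator of length $j>5$ by a wheel followed by $j-5$ alternating slicing operators. (Alternating means that consecutive ones are distinct.) A normalized Polish expression $\beta$ is a neighbour of a normalized Polish expression $\alpha$ (both of order $k$ with $n$ operands) if $\beta$ is obtained from $\alpha$ by a single move. The neighbourhood graph has these expressions as vertices, and two distinct expressions are joined by an edge if one of them is a neighbour of the other. Then there is an absolute constant $C$ such that, for all $k\ge 2$ and $n\ge 1$, the neighbourhood graph is connected and has diameter at most $Cn^2$; moreover, from every normalized Polish expression of order $k$ with $n$ operands one can reach every other one by a sequence of at most $Cn^2$ moves through such expressions. -/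

import Mathlib

namespace HFO

/-- A Baxter permutation `π` of `{0, …, m - 1}`: there are no positions `i < j < k < l` with
`π k < π i + 1 = π l < π j` or `π j < π i = π l + 1 < π k`. -/
def IsBaxter {m : ℕ} (π : Equiv.Perm (Fin m)) : Prop :=
  ¬ ∃ i j k l : Fin m, i < j ∧ j < k ∧ k < l ∧
    (((π k : ℕ) < (π i : ℕ) + 1 ∧ (π i : ℕ) + 1 = (π l : ℕ) ∧ (π l : ℕ) < (π j : ℕ)) ∨
     ((π j : ℕ) < (π i : ℕ) ∧ (π i : ℕ) = (π l : ℕ) + 1 ∧ (π l : ℕ) + 1 < (π k : ℕ)))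

/-- A simple permutation: every block (a segment of consecutive positions that is mapped onto a
range of consecutive values) is a single position or the whole permutation. -/
def IsSimple {m : ℕ} (π : Equiv.Perm (Fin m)) : Prop :=
  ∀ a b c d : Fin m, a ≤ b → (Finset.Icc a b).image π = Finset.Icc c d →
    a = b ∨ Finset.Icc a b = Finset.univ

/-- The operators of order `k`: the permutations of length `j`, `2 ≤ j ≤ k`, that are Baxter and
simple, that is, those which encode the uniquely `HFO_j` floorplans. -/
structure Operator (k : ℕ) where
  len : ℕ
  perm : Equiv.Perm (Fin len)
  two_le : 2 ≤ len
  le_order : len ≤ k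
  baxter : IsBaxter perm
  simple : IsSimple perm

/-- The slicing operators are `[12]` and `[21]`. -/
def Operator.IsSlicing {k : ℕ} (o : Operator k) : Prop := o.len = 2

/-- The elements of expressions: operands (there are `n` of them) and operators of order `k`. -/
inductive Token (n k : ℕ) where
  | operand : Fin n → Token n k
  | operator : Operator k → Token n k

/-- The number of operands in a word. -/
def operandCount {n k : ℕ} : List (Token n k) → ℕ
  | [] => 0
  | Token.operand _ :: w => operandCount w + 1
  | Token.operator _ :: w => operandCount w

/-- The sum of `j - 1` over the operators of a word, `j` being the length of the operator. -/
def operatorWeight {n k : ℕ} : List (Token n k) → ℕ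
  | [] => 0
  | Token.operand _ :: w => operatorWeight w
  | Token.operator o :: w => operatorWeight w + (o.len - 1)

/-- The word is the post-order traversal of a single tree: the operator weight of each nonempty
prefix is less than its number of operands, and for the whole word it is less by exactly one. -/
def IsComplete {n k : ℕ} (w : List (Token n k)) : Prop :=
  (∀ i : ℕ, 1 ≤ i → i ≤ w.length → operatorWeight (w.take i) < operandCount (w.take i)) ∧
    operatorWeight w + 1 = operandCount w

/-- Two consecutive elements are not `[12][12]` and not `[21][21]`. -/
def IsNormalized {n k : ℕ} (w : List (Token n k)) : Prop :=
  w.IsChain fun x y => ∀ o : Operator k, o.IsSlicing →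
    ¬ (x = Token.operator o ∧ y = Token.operator o)

/-- Normalized Polish expressions of order `k` with `n` operands. -/
structure IsNPE {n k : ℕ} (w : List (Token n k)) : Prop where
  operand_unique : ∀ a : Fin n, ∃! i : Fin w.length, w.get i = Token.operand a
  complete : IsComplete w
  normalized : IsNormalized w

/-- The solution space. -/
abbrev NPE (n k : ℕ) : Type := {w : List (Token n k) // IsNPE w}

/-- A word of operators, regarded as a word of tokens. -/
def ops {n k : ℕ} (c : List (Operator k)) : List (Token n k) := c.map Token.operator

/-- A chain of alternating slicing operators. -/
def IsAlternating {k : ℕ} (c : List (Operator k)) : Prop :=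
  (∀ o ∈ c, o.IsSlicing) ∧ c.IsChain (· ≠ ·)

/-- The chains `c` and `c'` of slicing operators are complements of each other: `[12]` and `[21]`
(the only two slicing operators) are exchanged at each position. -/
def IsComplement {k : ℕ} (c c' : List (Operator k)) : Prop :=
  List.Forall₂ (fun o o' => o.IsSlicing ∧ o'.IsSlicing ∧ o ≠ o') c c'

/-- The word that consists of components, each followed by some operators. -/
def assemble {n k : ℕ} (parts : List (List (Token n k) × List (Operator k))) :
    List (Token n k) :=
  parts.flatMap fun p => p.1 ++ ops p.2

/-- The moves. The result of a move is not required to be a normalized expression here; the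
neighbourhood relation below is between normalized expressions only. -/
inductive Move {n k : ℕ} : List (Token n k) → List (Token n k) → Prop
  /-- M1: swap two operands that are adjacent when operators are disregarded. -/
  | swapOperands (u w : List (Token n k)) (v : List (Operator k)) (a b : Fin n) :
      Move (u ++ [Token.operand a] ++ ops v ++ [Token.operand b] ++ w)
        (u ++ [Token.operand b] ++ ops v ++ [Token.operand a] ++ w)
  /-- M1: swap an operand with the operator after it. -/
  | swapOperandOperator (u w : List (Token n k)) (a : Fin n) (o : Operator k) :
      Move (u ++ [Token.operand a, Token.operator o] ++ w)
        (u ++ [Token.operator o, Token.operand a] ++ w)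
  /-- M1: swap an operator with the operand after it. -/
  | swapOperatorOperand (u w : List (Token n k)) (a : Fin n) (o : Operator k) :
      Move (u ++ [Token.operator o, Token.operand a] ++ w)
        (u ++ [Token.operand a, Token.operator o] ++ w)
  /-- M1: swap two adjacent operators, at most one of which is slicing. -/
  | swapOperators (u w : List (Token n k)) (o o' : Operator k)
      (h : ¬ (o.IsSlicing ∧ o'.IsSlicing)) :
      Move (u ++ [Token.operator o, Token.operator o'] ++ w)
        (u ++ [Token.operator o', Token.operator o] ++ w)
  /-- M2: complement a maximal chain of slicing operators. -/
  | complementChain (u w : List (Token n k)) (c c' : List (Operator k)) (hne : c ≠ [])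
      (hc : IsComplement c c')
      (hleft : ∀ o : Operator k, u.getLast? = some (Token.operator o) → ¬ o.IsSlicing)
      (hright : ∀ o : Operator k, w.head? = some (Token.operator o) → ¬ o.IsSlicing) :
      Move (u ++ ops c ++ w) (u ++ ops c' ++ w)
  /-- M2: replace an operator by another operator of the same length. -/
  | complementOperator (u w : List (Token n k)) (o o' : Operator k)
      (hlen : o'.len = o.len) (hne : o' ≠ o) :
      Move (u ++ [Token.operator o] ++ w) (u ++ [Token.operator o'] ++ w)
  /-- M3: a complete subexpression (a composite rectangle) that is assembled from `j` complete
  subexpressions (basic or composite rectangles), though not by a single operator of length `j`,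
  is rearranged: an operator of length `j` is applied to the same components. -/
  | create (u w : List (Token n k)) (parts : List (List (Token n k) × List (Operator k)))
      (o : Operator k) (hlen : parts.length = o.len)
      (hparts : ∀ p ∈ parts, IsComplete p.1)
      (hwhole : IsComplete (assemble parts))
      (hnot : ∀ o' : Operator k, o'.len = o.len → parts.flatMap Prod.snd ≠ [o']) :
      Move (u ++ assemble parts ++ w)
        (u ++ (parts.flatMap Prod.fst ++ [Token.operator o]) ++ w)
  /-- M4: replace a wheel (an operator of length 5) by four alternating slicing operators. -/
  | destroyWheel (u w : List (Token n k)) (o : Operator k) (c : List (Operator k))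
      (ho : o.len = 5) (hc : IsAlternating c) (hlen : c.length = 4) :
      Move (u ++ [Token.operator o] ++ w) (u ++ ops c ++ w)
  /-- M4: replace an operator of length `j > 5` by a wheel followed by `j - 5` alternating
  slicing operators. -/
  | destroy (u w : List (Token n k)) (o wheel : Operator k) (c : List (Operator k))
      (ho : 5 < o.len) (hwheel : wheel.len = 5) (hc : IsAlternating c)
      (hlen : c.length + 5 = o.len) :
      Move (u ++ [Token.operator o] ++ w) (u ++ ([Token.operator wheel] ++ ops c) ++ w)

/-- `β` is a neighbour of `α`: it is obtained from `α` by a single move. -/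
def Neighbour {n k : ℕ} (α β : NPE n k) : Prop := Move α.1 β.1

/-- The neighbourhood graph: distinct expressions are joined if one of them is obtained from the
other by a single move. -/
def neighbourhoodGraph (n k : ℕ) : SimpleGraph (NPE n k) := SimpleGraph.fromRel Neighbour

end HFO

namespace HFO

variable {n k : ℕ}

/-! ### Operators of small length -/

/-! Every expression is joined to one canonical expression, the sorted operands followed by an
alternating chain of slicing operators, using only moves that a single move undoes. Distances in
`reversibleGraph` are symmetric, so two such routes can be glued, and they serve both the undirected
graph and the directed sequences of moves.

Pushing operators to the right past operands removes at most `n ^ 2` inversions. A push can only be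
blocked by creating `[12][12]` or `[21][21]`, and complementing the slicing run that follows cures
this, so a push costs at most two moves (`exists_reach_swap`).

In a flat word the rightmost non-slicing operator is destroyed by M4, again after at most one
complementation (`exists_reach_destroy`). The total weight stays `n - 1` while the number of
operators grows, so there are fewer than `n` rounds. M3 undoes M4, since the word before the
operator splits into complete words (`move_create`). No operator has length 3 or 4, so M4 applies to
every non-slicing one.

Adjacent swaps then sort the operands (`reach_perm`), and one last complementation fixes the chain.
Completeness is tracked throughout as acceptance by a stack machine, which behaves well under
concatenation. -/

theorem not_simple_three (π : Equiv.Perm (Fin 3)) : ¬ IsSimple π := by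
  unfold IsSimple
  revert π
  decide +kernel

/-- The simple permutations of length four are 2413 and 3142, precisely the two patterns that the
Baxter condition forbids. -/
theorem not_baxter_simple_four (π : Equiv.Perm (Fin 4)) (hb : IsBaxter π) : ¬ IsSimple π := by
  unfold IsSimple
  unfold IsBaxter at hb
  revert π
  decide +kernel

/-- There are no operators of length three or four. -/
theorem Operator.five_le (o : Operator k) (h : ¬ o.IsSlicing) : 5 ≤ o.len := by
  obtain ⟨m, π, h1, h2, h3, h4⟩ := o
  change ¬ m = 2 at h
  change 5 ≤ m
  by_contra hm
  have : m = 3 ∨ m = 4 := by omega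
  rcases this with rfl | rfl
  · exact not_simple_three π h4
  · exact not_baxter_simple_four π h3 h4

theorem perm_two_eq (π ρ σ : Equiv.Perm (Fin 2)) (h : π ≠ ρ) (h' : π ≠ σ) : ρ = σ := by
  revert π ρ σ
  decide

/-- There are at most two slicing operators. -/
theorem Operator.IsSlicing.eq_of_ne {a b c : Operator k} (ha : a.IsSlicing) (hb : b.IsSlicing)
    (hc : c.IsSlicing) (hab : a ≠ b) (hac : a ≠ c) : b = c := by
  obtain ⟨m, π, h1, h2, h3, h4⟩ := a
  obtain ⟨m', π', h1', h2', h3', h4'⟩ := b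
  obtain ⟨m'', π'', h1'', h2'', h3'', h4''⟩ := c
  change m = 2 at ha
  change m' = 2 at hb
  change m'' = 2 at hc
  subst ha hb hc
  have := perm_two_eq π π' π'' (by rintro rfl; exact hab rfl) (by rintro rfl; exact hac rfl)
  subst this
  rfl

theorem isBaxter_two (π : Equiv.Perm (Fin 2)) : IsBaxter π := by
  unfold IsBaxter
  revert π
  decide +kernel

theorem isSimple_two (π : Equiv.Perm (Fin 2)) : IsSimple π := by
  unfold IsSimple
  revert π
  decide +kernel

theorem exists_slicing (hk : 2 ≤ k) :
    ∃ p q : Operator k, p.IsSlicing ∧ q.IsSlicing ∧ p ≠ q := by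
  refine ⟨⟨2, 1, le_rfl, hk, isBaxter_two _, isSimple_two _⟩,
    ⟨2, Equiv.swap 0 1, le_rfl, hk, isBaxter_two _, isSimple_two _⟩, rfl, rfl, ?_⟩
  intro h
  have h' : (1 : Equiv.Perm (Fin 2)) = Equiv.swap 0 1 := by simpa using h
  exact absurd h' (by decide)

/-- The wheel `[25314]`. -/
def wheelPerm : Equiv.Perm (Fin 5) where
  toFun := ![1, 4, 2, 0, 3]
  invFun := ![3, 0, 2, 4, 1]
  left_inv := by decide
  right_inv := by decide

theorem exists_wheel (hk : 5 ≤ k) : ∃ o : Operator k, o.len = 5 :=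
  ⟨⟨5, wheelPerm, by norm_num, hk, by unfold IsBaxter; decide +kernel,
    by unfold IsSimple; decide +kernel⟩, rfl⟩

/-! ### Completeness as acceptance by a stack machine -/

/-- The height of the stack after a token has been processed. -/
def step (s : ℕ) : Token n k → Option ℕ
  | Token.operand _ => some (s + 1)
  | Token.operator o => if o.len ≤ s then some (s + 1 - o.len) else none

/-- The height of the stack after a word has been processed. -/
def run (s : ℕ) (w : List (Token n k)) : Option ℕ := w.foldlM step s

@[simp] theorem run_nil (s : ℕ) : run s ([] : List (Token n k)) = some s := rfl

@[simp] theorem run_operand (s : ℕ) (a : Fin n) (w : List (Token n k)) :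
    run s (Token.operand a :: w) = run (s + 1) w := rfl

theorem run_operator (s : ℕ) (o : Operator k) (w : List (Token n k)) :
    run s (Token.operator o :: w) = if o.len ≤ s then run (s + 1 - o.len) w else none := by
  by_cases h : o.len ≤ s <;> simp [run, step, h]

theorem run_append (s : ℕ) (u v : List (Token n k)) :
    run s (u ++ v) = (run s u).bind fun t => run t v := by
  unfold run
  rw [List.foldlM_append]
  rfl

theorem run_append_eq_some {s t : ℕ} {u v : List (Token n k)} :
    run s (u ++ v) = some t ↔ ∃ r, run s u = some r ∧ run r v = some t := by
  rw [run_append, Option.bind_eq_some_iff]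

theorem run_add {s t : ℕ} {w : List (Token n k)} (h : run s w = some t) (r : ℕ) :
    run (s + r) w = some (t + r) := by
  induction w generalizing s with
  | nil => simp_all
  | cons x w ih =>
    cases x with
    | operand a =>
      rw [run_operand] at h ⊢
      rw [show s + r + 1 = s + 1 + r by ring]
      exact ih h
    | operator o =>
      rw [run_operator] at h ⊢
      split_ifs at h with h1
      rw [if_pos (by omega), show s + r + 1 - o.len = s + 1 - o.len + r by omega]
      exact ih h

/-- The height after a prefix is `s` plus its operands minus its weight, and an operator finds
enough entries on the stack exactly when it leaves a positive height. -/
theorem run_eq_some_iff (s t : ℕ) (w : List (Token n k)) :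
    run s w = some t ↔
      (∀ i : ℕ, 1 ≤ i → i ≤ w.length →
        operatorWeight (w.take i) < operandCount (w.take i) + s) ∧
      operatorWeight w + t = operandCount w + s := by
  induction w generalizing s with
  | nil =>
    simp only [run_nil, Option.some.injEq, List.length_nil, operatorWeight, operandCount]
    constructor
    · rintro rfl
      exact ⟨fun i h1 h2 => by omega, rfl⟩
    · rintro ⟨-, h⟩
      omega
  | cons x w ih =>
    cases x with
    | operand a =>
      rw [run_operand, ih]
      simp only [operatorWeight, operandCount, List.length_cons]
      refine and_congr ⟨fun h i h1 h2 => ?_, fun h i h1 h2 => ?_⟩ (by omega)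
      · obtain ⟨i, rfl⟩ : ∃ j, i = j + 1 := ⟨i - 1, by omega⟩
        simp only [List.take_succ_cons, operatorWeight, operandCount]
        rcases Nat.eq_zero_or_pos i with rfl | hi
        · simp [operatorWeight, operandCount]
        · have := h i hi (by omega)
          omega
      · have := h (i + 1) (by omega) (by omega)
        simp only [List.take_succ_cons, operatorWeight, operandCount] at this
        omega
    | operator o =>
      rw [run_operator]
      have ho := o.two_le
      simp only [operatorWeight, operandCount, List.length_cons]
      split_ifs with hle
      · rw [ih]
        refine and_congr ⟨fun h i h1 h2 => ?_, fun h i h1 h2 => ?_⟩ (by omega)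
        · obtain ⟨i, rfl⟩ : ∃ j, i = j + 1 := ⟨i - 1, by omega⟩
          simp only [List.take_succ_cons, operatorWeight, operandCount]
          rcases Nat.eq_zero_or_pos i with rfl | hi
          · simp only [List.take_zero, operatorWeight, operandCount]
            omega
          · have := h i hi (by omega)
            omega
        · have := h (i + 1) (by omega) (by omega)
          simp only [List.take_succ_cons, operatorWeight, operandCount] at this
          omega
      · simp only [false_iff]
        rintro ⟨h, -⟩
        have := h 1 le_rfl (by omega)
        simp only [List.take_succ_cons, List.take_zero, operatorWeight, operandCount] at this
        omega

theorem isComplete_iff (w : List (Token n k)) : IsComplete w ↔ run 0 w = some 1 := by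
  rw [run_eq_some_iff]
  rfl

/-- The sum of `j - 1` over a list of operators. -/
def weight (c : List (Operator k)) : ℕ := (c.map fun o => o.len - 1).sum

/-- An operator lowers the height by its length minus one and never empties the stack, whence `1 ≤
s`. -/
theorem run_ops (s : ℕ) (hs : 1 ≤ s) (c : List (Operator k)) :
    run (s + weight c) (ops c : List (Token n k)) = some s := by
  induction c with
  | nil => simp [weight, ops]
  | cons o c ih =>
    have ho := o.two_le
    have hw : weight (o :: c) = o.len - 1 + weight c := by simp [weight]
    have : (ops (o :: c) : List (Token n k)) = Token.operator o :: ops c := rfl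
    rw [this, run_operator, hw, if_pos (by omega),
      show s + (o.len - 1 + weight c) + 1 - o.len = s + weight c by omega]
    exact ih

theorem run_ops_congr (s : ℕ) {c d : List (Operator k)} (h : c.map (·.len) = d.map (·.len)) :
    run s (ops c : List (Token n k)) = run s (ops d : List (Token n k)) := by
  induction c generalizing s d with
  | nil =>
    obtain rfl : d = [] := by simpa using h.symm
    rfl
  | cons o c ih =>
    cases d with
    | nil => simp at h
    | cons o' d =>
      simp only [List.map_cons, List.cons.injEq] at h
      change run s (Token.operator o :: ops c : List (Token n k)) = run s (Token.operator o' :: ops d)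
      rw [run_operator, run_operator, h.1, ih _ h.2]

theorem run_flatten {L : List (List (Token n k))} (h : ∀ E ∈ L, IsComplete E) (s : ℕ) :
    run s L.flatten = some (s + L.length) := by
  induction L generalizing s with
  | nil => simp
  | cons E L ih =>
    rw [List.flatten_cons, run_append_eq_some]
    refine ⟨s + 1, ?_, ?_⟩
    · have := run_add ((isComplete_iff E).1 (h E (by simp))) s
      rwa [zero_add, add_comm] at this
    · rw [ih (fun E hE => h E (by simp [hE]))]
      simp only [List.length_cons, Option.some.injEq]
      omega

/-- A word that the stack machine accepts is the concatenation of complete words. -/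
theorem exists_complete_of_run {w : List (Token n k)} {t : ℕ} (h : run 0 w = some t) :
    ∃ L : List (List (Token n k)), (∀ E ∈ L, IsComplete E) ∧ L.flatten = w ∧ L.length = t := by
  induction w using List.reverseRecOn generalizing t with
  | nil => exact ⟨[], by simp, rfl, by simpa using h⟩
  | append_singleton w x ih =>
    obtain ⟨r, hr, hx⟩ := run_append_eq_some.1 h
    obtain ⟨L, hL, rfl, rfl⟩ := ih hr
    cases x with
    | operand a =>
      refine ⟨L ++ [[Token.operand a]], ?_, by simp, by simpa using hx⟩
      intro E hE
      rcases List.mem_append.1 hE with hE | hE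
      · exact hL E hE
      · obtain rfl : E = [Token.operand a] := by simpa using hE
        simp [isComplete_iff]
    | operator o =>
      rw [run_operator] at hx
      split_ifs at hx with hle
      have ho := o.two_le
      -- The operator merges the last `o.len` complete words, together with itself, into one.
      refine ⟨L.take (L.length - o.len) ++
        [(L.drop (L.length - o.len)).flatten ++ [Token.operator o]], ?_, ?_, ?_⟩
      · intro E hE
        rcases List.mem_append.1 hE with hE | hE
        · exact hL E (List.mem_of_mem_take hE)
        · obtain rfl := List.mem_singleton.1 hE
          rw [isComplete_iff, run_append_eq_some]
          refine ⟨_, run_flatten (fun E hE => hL E (List.mem_of_mem_drop hE)) 0, ?_⟩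
          rw [run_operator, List.length_drop, if_pos (by omega)]
          simp only [run_nil, Option.some.injEq]
          omega
      · simp only [List.flatten_append, List.flatten_cons, List.flatten_nil, List.append_nil]
        rw [← List.append_assoc, ← List.flatten_append, List.take_append_drop]
      · simp only [run_nil, Option.some.injEq] at hx
        simp only [List.length_append, List.length_take, List.length_singleton]
        omega

/-! ### Operands -/

/-- The operands of a word, in order. -/
def operands (w : List (Token n k)) : List (Fin n) :=
  w.filterMap fun x => match x with
    | Token.operand a => some a
    | Token.operator _ => none

@[simp] theorem operands_nil : operands ([] : List (Token n k)) = [] := rfl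

@[simp] theorem operands_cons_operand (a : Fin n) (w : List (Token n k)) :
    operands (Token.operand a :: w) = a :: operands w := rfl

@[simp] theorem operands_cons_operator (o : Operator k) (w : List (Token n k)) :
    operands (Token.operator o :: w) = operands w := rfl

@[simp] theorem operands_append (u v : List (Token n k)) :
    operands (u ++ v) = operands u ++ operands v := List.filterMap_append

@[simp] theorem operands_ops (c : List (Operator k)) :
    operands (ops c : List (Token n k)) = [] := by
  induction c with
  | nil => rfl
  | cons o c ih => exact ih

@[simp] theorem operands_map_operand (l : List (Fin n)) :
    operands (l.map Token.operand : List (Token n k)) = l := by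
  induction l with
  | nil => rfl
  | cons a l ih => simp [ih]

theorem length_operands (w : List (Token n k)) : (operands w).length = operandCount w := by
  induction w with
  | nil => rfl
  | cons x w ih => cases x <;> simp [operandCount, ih]

/-- Lets a unique position be handled by induction on the word, so that it can be turned into a
count of operands. -/
theorem existsUnique_get_cons {α : Type*} (P : α → Prop) (x : α) (w : List α) :
    (∃! i : Fin (x :: w).length, P ((x :: w).get i)) ↔
      (P x ∧ ∀ y ∈ w, ¬ P y) ∨ (¬ P x ∧ ∃! i : Fin w.length, P (w.get i)) := by
  constructor
  · rintro ⟨i, hi, hu⟩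
    induction i using Fin.cases with
    | zero =>
      refine Or.inl ⟨hi, fun y hy hPy => ?_⟩
      obtain ⟨j, rfl⟩ := List.get_of_mem hy
      exact absurd (hu j.succ hPy) (Fin.succ_ne_zero j)
    | succ i =>
      refine Or.inr ⟨fun hx => absurd (hu 0 hx) (Fin.succ_ne_zero i).symm, i, hi, fun j hj => ?_⟩
      exact Fin.succ_injective _ (hu j.succ hj)
  · rintro (⟨hx, hw⟩ | ⟨hx, i, hi, hu⟩)
    · refine ⟨0, hx, fun j hj => ?_⟩
      induction j using Fin.cases with
      | zero => rfl
      | succ j => exact absurd hj (hw _ (List.get_mem w j))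
    · refine ⟨i.succ, hi, fun j hj => ?_⟩
      induction j using Fin.cases with
      | zero => exact absurd hj hx
      | succ j => exact congrArg Fin.succ (hu j hj)

theorem mem_operands {a : Fin n} {w : List (Token n k)} :
    a ∈ operands w ↔ Token.operand a ∈ w := by
  induction w with
  | nil => simp
  | cons x w ih => cases x <;> simp [ih]

theorem existsUnique_operand_iff (a : Fin n) (w : List (Token n k)) :
    (∃! i : Fin w.length, w.get i = Token.operand a) ↔ (operands w).count a = 1 := by
  induction w with
  | nil =>
    simp only [operands_nil, List.count_nil, zero_ne_one, iff_false]
    rintro ⟨i, -⟩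
    exact i.elim0
  | cons x w ih =>
    rw [existsUnique_get_cons (fun y => y = Token.operand a), ih]
    have hmem : (∀ y ∈ w, ¬ y = Token.operand a) ↔ (operands w).count a = 0 := by
      rw [List.count_eq_zero, mem_operands]
      exact ⟨fun h h' => h _ h' rfl, fun h y hy hya => h (hya ▸ hy)⟩
    rw [hmem]
    cases x with
    | operand b =>
      by_cases hb : b = a
      · subst hb
        simp
      · simp [hb]
    | operator o => simp

theorem forall_existsUnique_operand_iff (w : List (Token n k)) :
    (∀ a : Fin n, ∃! i : Fin w.length, w.get i = Token.operand a) ↔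
      (operands w).Perm (List.finRange n) := by
  simp only [existsUnique_operand_iff]
  rw [List.perm_iff_count]
  refine forall_congr' fun a => ?_
  rw [List.count_eq_one_of_mem (List.nodup_finRange n) (List.mem_finRange a)]

/-! ### Normalization -/

/-- `[12][12]` and `[21][21]` are the pairs of operators that must not be consecutive. -/
def NotRepeat (o o' : Operator k) : Prop := o.IsSlicing → o ≠ o'

/-- The two tokens may be consecutive in a normalized expression. -/
def MayFollow (x y : Token n k) : Prop :=
  ∀ o : Operator k, o.IsSlicing → ¬ (x = Token.operator o ∧ y = Token.operator o)

@[simp] theorem mayFollow_operand_left (a : Fin n) (y : Token n k) :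
    MayFollow (Token.operand a) y := fun o _ h => by simp at h

@[simp] theorem mayFollow_operand_right (x : Token n k) (a : Fin n) :
    MayFollow x (Token.operand a) := fun o _ h => by simp at h

@[simp] theorem mayFollow_operator (o o' : Operator k) :
    MayFollow (Token.operator o : Token n k) (Token.operator o') ↔ NotRepeat o o' := by
  constructor
  · rintro h ho rfl
    exact h o ho ⟨rfl, rfl⟩
  · rintro h p hp ⟨h1, h2⟩
    obtain rfl : o = p := by simpa using h1
    obtain rfl : o' = o := by simpa using h2
    exact h hp rfl

theorem isChain_ops (c : List (Operator k)) :
    (ops c : List (Token n k)).IsChain MayFollow ↔ c.IsChain NotRepeat := by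
  unfold ops
  rw [List.isChain_map]
  simp only [mayFollow_operator]

theorem isNPE_iff (w : List (Token n k)) :
    IsNPE w ↔ (operands w).Perm (List.finRange n) ∧ run 0 w = some 1 ∧ w.IsChain MayFollow :=
  ⟨fun h => ⟨(forall_existsUnique_operand_iff w).1 h.1, (isComplete_iff w).1 h.2, h.3⟩,
    fun h => ⟨(forall_existsUnique_operand_iff w).2 h.1, (isComplete_iff w).2 h.2.1, h.2.2⟩⟩

theorem IsNPE.operandCount_eq {w : List (Token n k)} (h : IsNPE w) : operandCount w = n := by
  rw [← length_operands, ((isNPE_iff w).1 h).1.length_eq, List.length_finRange]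

/-! ### Reversible sequences of moves -/

/-- The graph of the moves that can be undone by a single move. -/
def reversibleGraph (n k : ℕ) : SimpleGraph (NPE n k) where
  Adj α β := α ≠ β ∧ Neighbour α β ∧ Neighbour β α
  symm := ⟨fun _ _ h => ⟨h.1.symm, h.2.2, h.2.1⟩⟩
  loopless := ⟨fun _ h => h.1 rfl⟩

/-- At most `m` reversible moves lead from one word to the other. -/
def Reach (m : ℕ) (w w' : List (Token n k)) : Prop :=
  ∃ (h : IsNPE w) (h' : IsNPE w'), (reversibleGraph n k).edist ⟨w, h⟩ ⟨w', h'⟩ ≤ m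

theorem Reach.refl {w : List (Token n k)} (h : IsNPE w) : Reach 0 w w :=
  ⟨h, h, by simp⟩

theorem Reach.mono {m m' : ℕ} {w w' : List (Token n k)} (h : Reach m w w') (hm : m ≤ m') :
    Reach m' w w' := by
  obtain ⟨h1, h2, h3⟩ := h
  exact ⟨h1, h2, h3.trans (by exact_mod_cast hm)⟩

theorem Reach.trans {m m' : ℕ} {w w' w'' : List (Token n k)} (h : Reach m w w')
    (h' : Reach m' w' w'') : Reach (m + m') w w'' := by
  obtain ⟨h1, h2, h3⟩ := h
  obtain ⟨h4, h5, h6⟩ := h'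
  refine ⟨h1, h5, (SimpleGraph.edist_triangle (v := ⟨w', h2⟩)).trans ?_⟩
  push_cast
  exact add_le_add h3 h6

theorem Reach.symm {m : ℕ} {w w' : List (Token n k)} (h : Reach m w w') : Reach m w' w := by
  obtain ⟨h1, h2, h3⟩ := h
  exact ⟨h2, h1, by rwa [SimpleGraph.edist_comm]⟩

theorem Reach.of_moves {w w' : List (Token n k)} (h : IsNPE w) (h' : IsNPE w')
    (hm : Move w w') (hm' : Move w' w) : Reach 1 w w' := by
  -- The graph has no loops, so a move that changes nothing is counted as distance zero.
  by_cases hw : w = w'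
  · subst hw
    exact (Reach.refl h).mono zero_le_one
  · refine ⟨h, h', ?_⟩
    have : (reversibleGraph n k).Adj ⟨w, h⟩ ⟨w', h'⟩ :=
      ⟨fun h => hw (congrArg Subtype.val h), hm, hm'⟩
    rw [SimpleGraph.edist_eq_one_iff_adj.2 this]
    simp

theorem Reach.left {m : ℕ} {w w' : List (Token n k)} (h : Reach m w w') : IsNPE w := h.1

theorem Reach.right {m : ℕ} {w w' : List (Token n k)} (h : Reach m w w') : IsNPE w' := h.2.1

/-! ### Complementing a chain -/

theorem isChain_append_of_left {u v : List (Token n k)} (hu : u.IsChain MayFollow)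
    (hv : v.IsChain MayFollow)
    (h : ∀ o : Operator k, u.getLast? = some (Token.operator o) → ¬ o.IsSlicing) :
    (u ++ v).IsChain MayFollow := by
  rw [List.isChain_append]
  refine ⟨hu, hv, fun x hx y _ o ho => ?_⟩
  rintro ⟨rfl, -⟩
  exact h o hx ho

theorem isChain_append_of_right {u v : List (Token n k)} (hu : u.IsChain MayFollow)
    (hv : v.IsChain MayFollow)
    (h : ∀ o : Operator k, v.head? = some (Token.operator o) → ¬ o.IsSlicing) :
    (u ++ v).IsChain MayFollow := by
  rw [List.isChain_append]
  refine ⟨hu, hv, fun x _ y hy o ho => ?_⟩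
  rintro ⟨-, rfl⟩
  exact h o hy ho

theorem IsComplement.symm {c c' : List (Operator k)} (h : IsComplement c c') :
    IsComplement c' c := by
  unfold IsComplement at h ⊢
  induction h with
  | nil => exact .nil
  | cons h _ ih => exact .cons ⟨h.2.1, h.1, h.2.2.symm⟩ ih

theorem IsComplement.map_len {c c' : List (Operator k)} (h : IsComplement c c') :
    c.map (·.len) = c'.map (·.len) := by
  unfold IsComplement at h
  induction h with
  | nil => rfl
  | cons h _ ih => rw [List.map_cons, List.map_cons, ih, h.1, h.2.1]

/-- Two equal neighbours in `c'` would come from two slicing operators that both differ from the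
same one; there are only two slicing operators, so these would coincide. -/
theorem IsComplement.isChain {c c' : List (Operator k)} (h : IsComplement c c')
    (hc : c.IsChain NotRepeat) : c'.IsChain NotRepeat := by
  unfold IsComplement at h
  induction h with
  | nil => exact .nil
  | cons h hl ih =>
    cases hl with
    | nil => exact .singleton _
    | cons h' hl' =>
      rw [List.isChain_cons_cons] at hc ⊢
      refine ⟨fun _ heq => hc.1 h.1 ?_, ih hc.2⟩
      subst heq
      exact h.2.1.eq_of_ne h.1 h'.1 h.2.2.symm h'.2.2.symm

theorem Operator.exists_slicing_ne (o : Operator k) : ∃ o' : Operator k, o'.IsSlicing ∧ o ≠ o' := by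
  obtain ⟨p, q, hp, hq, hpq⟩ := exists_slicing (o.two_le.trans o.le_order)
  by_cases h : o = p
  · exact ⟨q, hq, h ▸ hpq⟩
  · exact ⟨p, hp, h⟩

theorem exists_complement (c : List (Operator k)) (hc : ∀ o ∈ c, o.IsSlicing) :
    ∃ c', IsComplement c c' := by
  induction c with
  | nil => exact ⟨[], .nil⟩
  | cons o c ih =>
    obtain ⟨c', hc'⟩ := ih fun o ho => hc o (by simp [ho])
    obtain ⟨o', ho', hne⟩ := o.exists_slicing_ne
    exact ⟨o' :: c', .cons ⟨hc o (by simp), ho', hne⟩ hc'⟩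

theorem reach_complement {u w : List (Token n k)} {c c' : List (Operator k)}
    (h : IsNPE (u ++ ops c ++ w)) (hc : IsComplement c c')
    (hleft : ∀ o : Operator k, u.getLast? = some (Token.operator o) → ¬ o.IsSlicing)
    (hright : ∀ o : Operator k, w.head? = some (Token.operator o) → ¬ o.IsSlicing) :
    Reach 1 (u ++ ops c ++ w) (u ++ ops c' ++ w) := by
  by_cases hne : c = []
  · subst hne
    obtain rfl : c' = [] := by
      have := hc.map_len
      simpa using this.symm
    exact (Reach.refl h).mono zero_le_one
  have hne' : c' ≠ [] := by
    rintro rfl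
    exact hne (by simpa using hc.map_len)
  refine Reach.of_moves h ?_ (.complementChain u w c c' hne hc hleft hright)
    (.complementChain u w c' c hne' hc.symm hleft hright)
  rw [isNPE_iff] at h ⊢
  obtain ⟨h1, h2, h3⟩ := h
  refine ⟨by simpa using h1, ?_, ?_⟩
  · rw [run_append, run_append] at h2 ⊢
    simp only [← run_ops_congr _ hc.map_len]
    exact h2
  · rw [List.append_assoc] at h3 ⊢
    have hu := (List.isChain_append.1 h3).1
    have hcw := List.isChain_append.1 (List.isChain_append.1 h3).2.1
    exact isChain_append_of_left hu (isChain_append_of_right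
      ((isChain_ops c').2 (hc.isChain ((isChain_ops c).1 hcw.1))) hcw.2.1 hright) hleft

/-! ### Moving the operators behind the operands -/

/-- The number of pairs of an operator and a later operand. -/
def inversions : List (Token n k) → ℕ
  | [] => 0
  | Token.operand _ :: w => inversions w
  | Token.operator _ :: w => operandCount w + inversions w

/-- The prefix sees the tail only through its number of operands; the difference of inversions is
written without subtraction. -/
theorem inversions_append_congr (u : List (Token n k)) {v v' : List (Token n k)}
    (h : operandCount v = operandCount v') :
    operandCount (u ++ v) = operandCount (u ++ v') ∧
      inversions (u ++ v) + inversions v' = inversions (u ++ v') + inversions v := by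
  induction u with
  | nil => exact ⟨h, by simp [add_comm]⟩
  | cons x u ih =>
    cases x with
    | operand a =>
      simp only [List.cons_append, operandCount, inversions]
      omega
    | operator o =>
      simp only [List.cons_append, operandCount, inversions]
      omega

theorem inversions_le (w : List (Token n k)) :
    inversions w ≤ operatorWeight w * operandCount w := by
  induction w with
  | nil => simp [inversions]
  | cons x w ih =>
    cases x with
    | operand a =>
      simp only [operandCount, inversions, operatorWeight]
      exact ih.trans (Nat.mul_le_mul_left _ (Nat.le_succ _))
    | operator o =>
      simp only [operandCount, inversions, operatorWeight]
      have ho := o.two_le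
      have : operandCount w * 1 ≤ operandCount w * (o.len - 1) :=
        Nat.mul_le_mul_left _ (by omega)
      rw [add_mul]
      linarith

theorem inversions_ops_append (c : List (Operator k)) (w : List (Token n k)) :
    inversions (ops c ++ w) = c.length * operandCount w + inversions w := by
  induction c with
  | nil => simp [ops]
  | cons o c ih =>
    have hcount : operandCount (ops c ++ w) = operandCount w := by
      rw [← length_operands, ← length_operands]
      simp
    have : ops (o :: c) ++ w = Token.operator o :: (ops c ++ w) := rfl
    rw [this, inversions, ih, hcount, List.length_cons]
    ring

theorem exists_slicing_prefix (v : List (Token n k)) :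
    ∃ (c : List (Operator k)) (w : List (Token n k)), v = ops c ++ w ∧
      (∀ o ∈ c, o.IsSlicing) ∧
      ∀ o : Operator k, w.head? = some (Token.operator o) → ¬ o.IsSlicing := by
  induction v with
  | nil => exact ⟨[], [], rfl, by simp, by simp⟩
  | cons x v ih =>
    cases x with
    | operand a => exact ⟨[], Token.operand a :: v, rfl, by simp, by simp⟩
    | operator o =>
      by_cases ho : o.IsSlicing
      · obtain ⟨c, w, rfl, h1, h2⟩ := ih
        refine ⟨o :: c, w, rfl, ?_, h2⟩
        intro p hp
        rcases List.mem_cons.1 hp with rfl | hp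
        · exact ho
        · exact h1 p hp
      · refine ⟨[], Token.operator o :: v, rfl, by simp, ?_⟩
        intro p hp
        obtain rfl : o = p := by simpa using hp
        exact ho

/-- Pushing an operand earlier only raises the stack that the operator meets, and the operand
separates `o` from `u`. Only the junction of `o` with `v` can spoil normalization. -/
theorem reach_swap {u v : List (Token n k)} {o : Operator k} {a : Fin n}
    (h : IsNPE (u ++ [Token.operator o, Token.operand a] ++ v))
    (hv : ∀ o' : Operator k, v.head? = some (Token.operator o') → NotRepeat o o') :
    Reach 1 (u ++ [Token.operator o, Token.operand a] ++ v)
      (u ++ [Token.operand a, Token.operator o] ++ v) := by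
  refine Reach.of_moves h ?_ (.swapOperatorOperand u v a o) (.swapOperandOperator u v a o)
  rw [isNPE_iff] at h ⊢
  obtain ⟨h1, h2, h3⟩ := h
  refine ⟨by simpa using h1, ?_, ?_⟩
  · rw [List.append_assoc, run_append_eq_some] at h2 ⊢
    obtain ⟨r, hr, h2⟩ := h2
    refine ⟨r, hr, ?_⟩
    rw [List.cons_append, run_operator] at h2
    split_ifs at h2 with hle
    rw [List.cons_append, run_operand, List.cons_append, run_operator, if_pos (by omega)]
    rw [List.cons_append, run_operand] at h2
    rw [show r + 1 + 1 - o.len = r + 1 - o.len + 1 by omega]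
    exact h2
  · rw [List.append_assoc, List.isChain_append] at h3 ⊢
    obtain ⟨hu, hw, -⟩ := h3
    refine ⟨hu, ?_, ?_⟩
    · simp only [List.cons_append, List.nil_append, List.isChain_cons_cons] at hw ⊢
      refine ⟨mayFollow_operand_left _ _, ?_⟩
      rw [List.isChain_cons]
      refine ⟨fun y hy => ?_, (List.isChain_cons.1 hw.2).2⟩
      cases y with
      | operand b => simp
      | operator o' => exact (mayFollow_operator _ _).2 (hv o' hy)
    · intro x _ y hy
      obtain rfl : Token.operand a = y := by simpa using hy
      simp

theorem exists_reach_swap {u v : List (Token n k)} {o : Operator k} {a : Fin n}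
    (h : IsNPE (u ++ [Token.operator o, Token.operand a] ++ v)) :
    ∃ w, Reach 2 (u ++ [Token.operator o, Token.operand a] ++ v) w ∧
      inversions w < inversions (u ++ [Token.operator o, Token.operand a] ++ v) := by
  obtain ⟨c, v, rfl, hc, hv⟩ := exists_slicing_prefix v
  have key : ∀ d : List (Operator k), d.length = c.length →
      inversions (u ++ [Token.operand a, Token.operator o] ++ (ops d ++ v)) <
        inversions (u ++ [Token.operator o, Token.operand a] ++ (ops c ++ v)) := by
    intro d hd
    have hcount : ∀ d : List (Operator k), operandCount (ops d ++ v) = operandCount v := by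
      intro d
      rw [← length_operands, ← length_operands]
      simp
    rw [List.append_assoc, List.append_assoc]
    have := (inversions_append_congr u
      (v := [Token.operand a, Token.operator o] ++ (ops d ++ v))
      (v' := [Token.operator o, Token.operand a] ++ (ops c ++ v))
      (by simp [operandCount, hcount])).2
    simp only [List.cons_append, List.nil_append, inversions, operandCount, hcount,
      inversions_ops_append, hd] at this ⊢
    omega
  by_cases hrep : ∀ o' : Operator k,
      (ops c ++ v).head? = some (Token.operator o') → NotRepeat o o'
  · exact ⟨_, (reach_swap h hrep).mono one_le_two, key c rfl⟩
  · push Not at hrep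
    obtain ⟨o', ho', hoo'⟩ := hrep
    unfold NotRepeat at hoo'
    push Not at hoo'
    obtain ⟨ho, rfl⟩ := hoo'
    -- The run `c` begins with `o` itself. It is maximal, having the operand `a` on its left, so it
    -- may be complemented, after which its first operator differs from `o`.
    obtain ⟨c', hc'⟩ := exists_complement c hc
    have hr : Reach 1 (u ++ [Token.operator o, Token.operand a] ++ (ops c ++ v))
        (u ++ [Token.operator o, Token.operand a] ++ (ops c' ++ v)) := by
      have := reach_complement (u := u ++ [Token.operator o, Token.operand a]) (w := v)
        (by simpa using h) hc' (by simp) hv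
      simpa using this
    refine ⟨_, hr.trans (reach_swap hr.right ?_), key c' ?_⟩
    · intro p hp _
      cases hc' with
      | nil => exact absurd ho (hv o (by simpa [ops] using ho'))
      | cons hxy _ =>
        simp only [ops, List.map_cons, List.cons_append, List.head?_cons, Option.some.injEq,
          Token.operator.injEq] at ho' hp
        subst ho' hp
        exact hxy.2.2
    · have := congrArg List.length hc'.map_len
      simpa using this.symm

/-- The word that consists of the given operands, followed by the given operators. -/
def flat (l : List (Fin n)) (c : List (Operator k)) : List (Token n k) :=
  l.map Token.operand ++ ops c

theorem eq_flat_or_exists_operator_operand (w : List (Token n k)) :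
    (∃ l c, w = flat l c) ∨
      ∃ u o a v, w = u ++ [Token.operator o, Token.operand a] ++ v := by
  induction w with
  | nil => exact Or.inl ⟨[], [], rfl⟩
  | cons x w ih =>
    rcases ih with ⟨l, c, rfl⟩ | ⟨u, o, a, v, rfl⟩
    · cases x with
      | operand a => exact Or.inl ⟨a :: l, c, rfl⟩
      | operator o =>
        cases l with
        | nil => exact Or.inl ⟨[], o :: c, rfl⟩
        | cons a l => exact Or.inr ⟨[], o, a, flat l c, rfl⟩
    · exact Or.inr ⟨x :: u, o, a, v, rfl⟩

theorem exists_reach_flat_of_inversions_le (m : ℕ) {w : List (Token n k)} (h : IsNPE w)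
    (hm : inversions w ≤ m) : ∃ l c, Reach (2 * m) w (flat l c) := by
  induction m generalizing w with
  | zero =>
    rcases eq_flat_or_exists_operator_operand w with ⟨l, c, rfl⟩ | ⟨u, o, a, v, rfl⟩
    · exact ⟨l, c, Reach.refl h⟩
    · obtain ⟨w', -, hw'⟩ := exists_reach_swap h
      omega
  | succ m ih =>
    rcases eq_flat_or_exists_operator_operand w with ⟨l, c, rfl⟩ | ⟨u, o, a, v, rfl⟩
    · exact ⟨l, c, (Reach.refl h).mono (Nat.zero_le _)⟩
    · obtain ⟨w', hr, hw'⟩ := exists_reach_swap h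
      obtain ⟨l, c, hlc⟩ := ih hr.right (by omega)
      exact ⟨l, c, (hr.trans hlc).mono (by omega)⟩

theorem exists_reach_flat {w : List (Token n k)} (h : IsNPE w) :
    ∃ l c, Reach (2 * n ^ 2) w (flat l c) := by
  refine exists_reach_flat_of_inversions_le (n ^ 2) h ((inversions_le w).trans ?_)
  have h1 := h.complete.2
  have h2 := h.operandCount_eq
  rw [h2, pow_two]
  exact Nat.mul_le_mul_right _ (by omega)

/-- With all operands in front, the prefix condition follows from the total weight, so the order of
the operands and of the operators no longer affects completeness. -/
theorem isNPE_flat_iff (l : List (Fin n)) (c : List (Operator k)) :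
    IsNPE (flat l c) ↔
      l.Perm (List.finRange n) ∧ weight c + 1 = n ∧ c.IsChain NotRepeat := by
  have hop : operands (flat l c) = l := by simp [flat]
  have hrun : ∀ s, run s (l.map Token.operand : List (Token n k)) = some (s + l.length) := by
    induction l with
    | nil => simp
    | cons a l ih =>
      intro s
      rw [List.map_cons, run_operand, ih (by simp [flat]), List.length_cons]
      congr 1
      ring
  have hweight : operatorWeight (flat l c) = weight c := by
    unfold flat
    clear hrun hop
    induction l with
    | nil =>
      induction c with
      | nil => rfl
      | cons o c ih =>
        change operatorWeight (ops c) + (o.len - 1) = _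
        rw [show operatorWeight (ops c : List (Token n k)) = weight c from ih]
        simp [weight, add_comm]
    | cons a l ih => exact ih
  have hchain : (flat l c : List (Token n k)).IsChain MayFollow ↔ c.IsChain NotRepeat := by
    rw [← isChain_ops (n := n)]
    refine ⟨fun h => (List.isChain_append.1 h).2.1, fun h => isChain_append_of_left ?_ h ?_⟩
    · rw [List.isChain_map]
      exact (List.pairwise_of_forall fun a b => mayFollow_operand_left a _).isChain
    · intro o ho
      have := List.mem_of_getLast? ho
      simp at this
  constructor
  · intro h
    have h1 := h.complete.2
    rw [h.operandCount_eq, hweight] at h1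
    have h2 := (isNPE_iff _).1 h
    exact ⟨hop ▸ h2.1, h1, hchain.1 h2.2.2⟩
  · rintro ⟨h1, h2, h3⟩
    rw [isNPE_iff, hop, hchain]
    refine ⟨h1, ?_, h3⟩
    unfold flat
    rw [run_append_eq_some]
    refine ⟨_, hrun 0, ?_⟩
    rw [h1.length_eq, List.length_finRange, ← h2, zero_add, add_comm]
    exact run_ops 1 le_rfl c

/-! ### Alternating chains -/

/-- The alternating chain of length `m` that starts with `p`. -/
def alternate (p q : Operator k) : ℕ → List (Operator k)
  | 0 => []
  | m + 1 => p :: alternate q p m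

theorem length_alternate (p q : Operator k) (m : ℕ) : (alternate p q m).length = m := by
  induction m generalizing p q with
  | zero => rfl
  | succ m ih => simp [alternate, ih]

theorem isAlternating_alternate {p q : Operator k} (hp : p.IsSlicing) (hq : q.IsSlicing)
    (hpq : p ≠ q) (m : ℕ) : IsAlternating (alternate p q m) := by
  induction m generalizing p q with
  | zero => exact ⟨by simp [alternate], .nil⟩
  | succ m ih =>
    obtain ⟨h1, h2⟩ := ih hq hp hpq.symm
    refine ⟨?_, ?_⟩
    · intro o ho
      rcases List.mem_cons.1 ho with rfl | ho
      · exact hp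
      · exact h1 o ho
    · rw [alternate, List.isChain_cons]
      refine ⟨?_, h2⟩
      cases m with
      | zero => simp [alternate]
      | succ m =>
        intro y hy
        obtain rfl : q = y := by simpa [alternate] using hy
        exact hpq

theorem IsAlternating.eq_alternate {p q : Operator k} (hq : q.IsSlicing) (hpq : p ≠ q)
    {c : List (Operator k)} (h : IsAlternating (p :: c)) :
    p :: c = alternate p q (c.length + 1) := by
  induction c generalizing p q with
  | nil => rfl
  | cons r c ih =>
    have hp : p.IsSlicing := h.1 p (by simp)
    have hr : r.IsSlicing := h.1 r (by simp)
    have hch := List.isChain_cons_cons.1 h.2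
    obtain rfl : r = q := hp.eq_of_ne hr hq hch.1 hpq
    rw [alternate, List.length_cons, ← ih hp hpq.symm ⟨fun o ho => h.1 o (List.mem_cons_of_mem _ ho), hch.2⟩]

theorem isComplement_alternate {p q : Operator k} (hp : p.IsSlicing) (hq : q.IsSlicing)
    (hpq : p ≠ q) (m : ℕ) : IsComplement (alternate p q m) (alternate q p m) := by
  induction m generalizing p q with
  | zero => exact .nil
  | succ m ih => exact .cons ⟨hp, hq, hpq⟩ (ih hq hp hpq.symm)

/-- Alternating chains of the same length are equal or complements. -/
theorem IsAlternating.eq_or_isComplement {c d : List (Operator k)} (hc : IsAlternating c)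
    (hd : IsAlternating d) (h : c.length = d.length) : c = d ∨ IsComplement c d := by
  cases c with
  | nil => exact Or.inl (List.length_eq_zero_iff.1 h.symm).symm
  | cons p c =>
    cases d with
    | nil => simp at h
    | cons q d =>
      have hp : p.IsSlicing := hc.1 p (by simp)
      have hq : q.IsSlicing := hd.1 q (by simp)
      have hl : c.length = d.length := by simpa using h
      by_cases hpq : p = q
      · subst hpq
        obtain ⟨r, hr, hpr⟩ := p.exists_slicing_ne
        left
        rw [hc.eq_alternate hr hpr, hd.eq_alternate hr hpr, hl]
      · right
        rw [hc.eq_alternate hq hpq, hd.eq_alternate hp (Ne.symm hpq), hl]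
        exact isComplement_alternate hp hq hpq _

/-- Of the two slicing operators, at least one differs from the last entry of `c`, and the chain may
start with it. -/
theorem exists_alternating (hk : 2 ≤ k) (m : ℕ) (c : List (Operator k)) :
    ∃ d : List (Operator k), IsAlternating d ∧ d.length = m ∧
      ∀ x ∈ c.getLast?, ∀ y ∈ d.head?, NotRepeat x y := by
  obtain ⟨p, q, hp, hq, hpq⟩ := exists_slicing hk
  by_cases h : p ∈ c.getLast?
  · refine ⟨alternate q p m, isAlternating_alternate hq hp hpq.symm m, length_alternate q p m, ?_⟩
    intro x hx y hy _
    obtain rfl : p = x := Option.mem_unique h hx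
    cases m with
    | zero => simp [alternate] at hy
    | succ m =>
      obtain rfl : q = y := by simpa [alternate] using hy
      exact hpq
  · refine ⟨alternate p q m, isAlternating_alternate hp hq hpq m, length_alternate p q m, ?_⟩
    intro x hx y hy _
    cases m with
    | zero => simp [alternate] at hy
    | succ m =>
      obtain rfl : p = y := by simpa [alternate] using hy
      rintro rfl
      exact h hx

theorem IsAlternating.isChain {c : List (Operator k)} (h : IsAlternating c) :
    c.IsChain NotRepeat := h.2.imp fun _ _ h _ => h

theorem IsAlternating.of_append {c d : List (Operator k)} (h : IsAlternating (c ++ d)) :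
    IsAlternating c ∧ IsAlternating d := by
  have := List.isChain_append.1 h.2
  exact ⟨⟨fun o ho => h.1 o (by simp [ho]), this.1⟩, ⟨fun o ho => h.1 o (by simp [ho]), this.2.1⟩⟩

/-- A chain of slicing operators at the end of an expression can be replaced by any alternating
chain of the same length. -/
theorem reach_alternating {l : List (Fin n)} {c d d' : List (Operator k)}
    (h : IsNPE (flat l (c ++ d))) (hd : IsAlternating d) (hd' : IsAlternating d')
    (hlen : d.length = d'.length) (hc : ∀ o ∈ c.getLast?, ¬ o.IsSlicing) :
    Reach 1 (flat l (c ++ d)) (flat l (c ++ d')) := by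
  rcases hd.eq_or_isComplement hd' hlen with rfl | hcomp
  · exact (Reach.refl h).mono zero_le_one
  · have e : ∀ d : List (Operator k), (flat l (c ++ d) : List (Token n k)) =
        (flat l c) ++ ops d ++ [] := by
      intro d
      simp [flat, ops]
    rw [e] at h
    rw [e, e]
    refine reach_complement h hcomp ?_ (by simp)
    intro o ho
    unfold flat ops at ho
    rw [List.getLast?_append, List.getLast?_map] at ho
    cases hcl : c.getLast? with
    | none =>
      rw [hcl] at ho
      simp at ho
    | some x =>
      rw [hcl] at ho
      obtain rfl : x = o := by simpa using ho
      exact hc x hcl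

/-! ### Destroying the operators that are not slicing -/

theorem weight_append (c d : List (Operator k)) : weight (c ++ d) = weight c + weight d := by
  simp [weight]

theorem weight_cons (o : Operator k) (c : List (Operator k)) :
    weight (o :: c) = o.len - 1 + weight c := by
  simp [weight]

theorem length_le_weight (c : List (Operator k)) : c.length ≤ weight c := by
  induction c with
  | nil => simp
  | cons o c ih =>
    have := o.two_le
    rw [weight_cons, List.length_cons]
    omega

theorem weight_of_slicing {c : List (Operator k)} (h : ∀ o ∈ c, o.IsSlicing) :
    weight c = c.length := by
  induction c with
  | nil => simp [weight]
  | cons o c ih =>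
    have ho : o.len = 2 := h o (by simp)
    rw [weight_cons, List.length_cons, ih fun p hp => h p (by simp [hp]), ho]
    omega

/-- The replacement of an operator by several operators of the same total weight is undone by the
creation of the operator. -/
theorem move_create {u w : List (Token n k)} {o : Operator k} {r : List (Operator k)}
    (h : IsNPE (u ++ [Token.operator o] ++ w)) (hr : weight r + 1 = o.len)
    (hr' : 2 ≤ r.length) :
    Move (u ++ ops r ++ w) (u ++ [Token.operator o] ++ w) := by
  have h2 := ((isNPE_iff _).1 h).2.1
  rw [List.append_assoc, run_append_eq_some] at h2
  obtain ⟨s, hs, h2⟩ := h2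
  rw [List.cons_append, run_operator] at h2
  split_ifs at h2 with hle
  -- The stack before the operator is a list of complete words; its last `o.len` entries are the
  -- components to which M3 applies.
  obtain ⟨L, hL, rfl, rfl⟩ := exists_complete_of_run hs
  obtain ⟨L₁, L₂, rfl, hlen⟩ : ∃ L₁ L₂, L = L₁ ++ L₂ ∧ L₂.length = o.len :=
    ⟨L.take (L.length - o.len), L.drop (L.length - o.len), (List.take_append_drop _ _).symm,
      by rw [List.length_drop]; omega⟩
  have ho := o.two_le
  obtain ⟨L₃, E, rfl⟩ : ∃ L₃ E, L₂ = L₃ ++ [E] := by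
    rcases List.eq_nil_or_concat' L₂ with rfl | h
    · simp at hlen; omega
    · exact h
  -- All operators of `r` are attached to the last component. As `r` has at least two of them, the
  -- side condition of M3 holds.
  let parts : List (List (Token n k) × List (Operator k)) := L₃.map (fun e => (e, [])) ++ [(E, r)]
  have hfst : parts.flatMap Prod.fst = (L₃ ++ [E]).flatten := by
    simp [parts, List.flatMap_def, Function.comp_def]
  have hsnd : parts.flatMap Prod.snd = r := by
    simp [parts, List.flatMap_map]
  have hass : assemble parts = (L₃ ++ [E]).flatten ++ ops r := by
    simp [parts, assemble, List.flatMap_def, ops, Function.comp_def]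
  have hL' : ∀ e ∈ L₃ ++ [E], IsComplete e := fun e he => hL e (List.mem_append_right _ he)
  have key := Move.create L₁.flatten w parts o (by simpa [parts] using hlen) ?_ ?_ ?_
  · rw [hass, hfst] at key
    simpa only [List.flatten_append, List.append_assoc] using key
  · intro p hp
    rcases List.mem_append.1 hp with hp | hp
    · obtain ⟨e, he, rfl⟩ := List.mem_map.1 hp
      exact hL' e (by simp [he])
    · obtain rfl := List.mem_singleton.1 hp
      exact hL' E (by simp)
  · rw [isComplete_iff, hass, run_append_eq_some]
    refine ⟨_, run_flatten hL' 0, ?_⟩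
    rw [hlen, ← hr, zero_add, add_comm]
    exact run_ops 1 le_rfl r
  · intro o' _ he
    rw [hsnd] at he
    simp [he] at hr'

theorem reach_destroy {l : List (Fin n)} {c r d : List (Operator k)} {o : Operator k}
    (h : IsNPE (flat l (c ++ o :: d))) (h' : (c ++ (r ++ d)).IsChain NotRepeat)
    (hr : weight r + 1 = o.len) (hr' : 2 ≤ r.length)
    (hmove : ∀ u w : List (Token n k), Move (u ++ [Token.operator o] ++ w) (u ++ ops r ++ w)) :
    Reach 1 (flat l (c ++ o :: d)) (flat l (c ++ (r ++ d))) := by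
  have hn := (isNPE_flat_iff _ _).1 h
  have hN : IsNPE (flat l (c ++ (r ++ d)) : List (Token n k)) := by
    refine (isNPE_flat_iff _ _).2 ⟨hn.1, ?_, h'⟩
    have := hn.2.1
    rw [weight_append, weight_cons] at this
    rw [weight_append, weight_append]
    omega
  have e1 : (flat l (c ++ o :: d) : List (Token n k)) =
      flat l c ++ [Token.operator o] ++ ops d := by
    simp [flat, ops]
  have e2 : (flat l (c ++ (r ++ d)) : List (Token n k)) = flat l c ++ ops r ++ ops d := by
    simp [flat, ops]
  rw [e1] at h ⊢
  rw [e2] at hN ⊢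
  exact Reach.of_moves h hN (hmove _ _) (move_create h hr hr')

/-- Taking the last non-slicing operator makes everything after it a single chain, which one move
can complement. -/
theorem isAlternating_or_exists_not_slicing {c : List (Operator k)} (h : c.IsChain NotRepeat) :
    IsAlternating c ∨ ∃ c₁ o c₂, c = c₁ ++ o :: c₂ ∧ ¬ o.IsSlicing ∧ IsAlternating c₂ := by
  induction c with
  | nil => exact Or.inl ⟨by simp, .nil⟩
  | cons p c ih =>
    rcases ih (List.isChain_cons.1 h).2 with hc | ⟨c₁, o, c₂, rfl, ho, hc₂⟩
    · by_cases hp : p.IsSlicing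
      · refine Or.inl ⟨?_, ?_⟩
        · intro o ho
          rcases List.mem_cons.1 ho with rfl | ho
          · exact hp
          · exact hc.1 o ho
        · exact List.isChain_cons.2 ⟨fun y hy => (List.isChain_cons.1 h).1 y hy hp, hc.2⟩
      · exact Or.inr ⟨[], p, c, rfl, hp, hc⟩
    · exact Or.inr ⟨p :: c₁, o, c₂, rfl, ho, hc₂⟩

theorem exists_reach_destroy {l : List (Fin n)} {c c₂ : List (Operator k)} {o : Operator k}
    (h : IsNPE (flat l (c ++ o :: c₂))) (ho : ¬ o.IsSlicing) (hc₂ : IsAlternating c₂) :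
    ∃ c', Reach 2 (flat l (c ++ o :: c₂)) (flat l c') ∧ (c ++ o :: c₂).length < c'.length := by
  have h5 := o.five_le ho
  have hn := (isNPE_flat_iff _ _).1 h
  have hchain := List.isChain_append.1 hn.2.2
  have hchange : ∀ d₂ : List (Operator k), IsAlternating d₂ → c₂.length = d₂.length →
      Reach 1 (flat l (c ++ o :: c₂) : List (Token n k)) (flat l (c ++ o :: d₂)) := by
    intro d₂ hd₂ hlen
    have e : ∀ d : List (Operator k), c ++ o :: d = (c ++ [o]) ++ d := by simp
    rw [e c₂] at h
    rw [e c₂, e d₂]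
    exact reach_alternating h hc₂ hd₂ hlen (by simpa using ho)
  -- One alternating chain is cut in two: `d₁` will come from the destroyed operator and `d₂`
  -- replaces `c₂` beforehand, so their junction is automatically admissible.
  have hsplit : ∀ (m : ℕ) (b : List (Operator k)), ∃ d₁ d₂ : List (Operator k),
      IsAlternating (d₁ ++ d₂) ∧ d₁.length = m ∧ c₂.length = d₂.length ∧
      ∀ x ∈ b.getLast?, ∀ y ∈ (d₁ ++ d₂).head?, NotRepeat x y := by
    intro m b
    obtain ⟨d, hd, hlen, hx⟩ := exists_alternating (o.two_le.trans o.le_order) (m + c₂.length) b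
    refine ⟨d.take m, d.drop m, ?_, ?_, ?_, ?_⟩
    · rwa [List.take_append_drop]
    · rw [List.length_take]; omega
    · rw [List.length_drop]; omega
    · rwa [List.take_append_drop]
  rcases h5.eq_or_lt with h5 | h5
  -- The new chain abuts `c`, so its first operator must be chosen accordingly.
  · obtain ⟨d₁, d₂, hd, hlen₁, hlen₂, hx⟩ := hsplit 4 c
    have h1 := hchange d₂ hd.of_append.2 hlen₂
    refine ⟨_, h1.trans (reach_destroy (r := d₁) h1.right ?_ ?_ (by omega) ?_), ?_⟩
    · exact List.isChain_append.2 ⟨hchain.1, hd.isChain, hx⟩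
    · rw [weight_of_slicing hd.of_append.1.1]
      omega
    · exact fun u w => .destroyWheel u w o d₁ h5.symm hd.of_append.1 hlen₁
    · simp only [List.length_append, List.length_cons]
      omega
  · obtain ⟨wheel, hwheel⟩ := exists_wheel (h5.le.trans o.le_order)
    have hwheel' : ¬ wheel.IsSlicing := by
      unfold Operator.IsSlicing
      omega
    -- Here the wheel shields the new chain from `c`, and its first operator is free.
    obtain ⟨d₁, d₂, hd, hlen₁, hlen₂, hx⟩ := hsplit (o.len - 5) []
    have h1 := hchange d₂ hd.of_append.2 hlen₂
    refine ⟨_, h1.trans (reach_destroy (r := wheel :: d₁) h1.right ?_ ?_ ?_ ?_), ?_⟩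
    · refine List.isChain_append.2 ⟨hchain.1, ?_, ?_⟩
      · rw [List.cons_append, List.isChain_cons]
        exact ⟨fun y _ hw => absurd hw hwheel', hd.isChain⟩
      · intro x _ y hy hxs
        obtain rfl : wheel = y := by simpa using hy
        rintro rfl
        exact hwheel' hxs
    · rw [weight_cons, weight_of_slicing hd.of_append.1.1]
      omega
    · rw [List.length_cons]
      omega
    · exact fun u w => .destroy u w o wheel d₁ h5 hwheel hd.of_append.1 (by omega)
    · simp only [List.length_append, List.length_cons]
      omega

/-- The excess of the weight over the number of operators is never negative and drops with each
destruction, because the weight is fixed at `n - 1`. -/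
theorem exists_reach_alternating_of_le (m : ℕ) {l : List (Fin n)} {c : List (Operator k)}
    (h : IsNPE (flat l c)) (hm : weight c ≤ c.length + m) :
    ∃ d, IsAlternating d ∧ Reach (2 * m) (flat l c) (flat l d) := by
  induction m generalizing c with
  | zero =>
    rcases isAlternating_or_exists_not_slicing ((isNPE_flat_iff _ _).1 h).2.2 with
      hc | ⟨c₁, o, c₂, rfl, ho, hc₂⟩
    · exact ⟨c, hc, Reach.refl h⟩
    · obtain ⟨c', hr, hlt⟩ := exists_reach_destroy h ho hc₂
      have h1 := ((isNPE_flat_iff _ _).1 h).2.1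
      have h2 := ((isNPE_flat_iff _ _).1 hr.right).2.1
      have h3 := length_le_weight c'
      omega
  | succ m ih =>
    rcases isAlternating_or_exists_not_slicing ((isNPE_flat_iff _ _).1 h).2.2 with
      hc | ⟨c₁, o, c₂, rfl, ho, hc₂⟩
    · exact ⟨c, hc, (Reach.refl h).mono (Nat.zero_le _)⟩
    · obtain ⟨c', hr, hlt⟩ := exists_reach_destroy h ho hc₂
      have h1 := ((isNPE_flat_iff _ _).1 h).2.1
      have h2 := ((isNPE_flat_iff _ _).1 hr.right).2.1
      obtain ⟨d, hd, hrd⟩ := ih hr.right (by omega)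
      exact ⟨d, hd, (hr.trans hrd).mono (by omega)⟩

theorem exists_reach_alternating {l : List (Fin n)} {c : List (Operator k)}
    (h : IsNPE (flat l c)) :
    ∃ d, IsAlternating d ∧ Reach (2 * n) (flat l c) (flat l d) := by
  have := ((isNPE_flat_iff _ _).1 h).2.1
  exact exists_reach_alternating_of_le n h (by omega)

/-! ### Sorting the operands -/

theorem reach_move_to_front {b x y : List (Fin n)} {a : Fin n} {c : List (Operator k)}
    (h : IsNPE (flat (b ++ (x ++ a :: y)) c)) :
    Reach x.length (flat (b ++ (x ++ a :: y)) c) (flat (b ++ a :: (x ++ y)) c) := by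
  induction x using List.reverseRecOn generalizing y with
  | nil => exact Reach.refl h
  | append_singleton x e ih =>
    have hn := (isNPE_flat_iff _ _).1 h
    have e1 : b ++ (x ++ [e] ++ a :: y) = b ++ (x ++ e :: a :: y) := by simp
    have e2 : b ++ a :: (x ++ [e] ++ y) = b ++ a :: (x ++ e :: y) := by simp
    rw [e1] at h hn
    rw [e1, e2]
    have hN : IsNPE (flat (b ++ (x ++ a :: e :: y)) c : List (Token n k)) := by
      refine (isNPE_flat_iff _ _).2 ⟨?_, hn.2⟩
      exact (((List.Perm.swap e a y).append_left x).append_left b).trans hn.1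
    have hmove : ∀ e a : Fin n, Move (flat (b ++ (x ++ e :: a :: y)) c : List (Token n k))
        (flat (b ++ (x ++ a :: e :: y)) c) := by
      intro e a
      have := Move.swapOperands (n := n) (k := k) ((b ++ x).map Token.operand) (flat y c) [] e a
      simpa [flat, ops] using this
    have h1 := Reach.of_moves h hN (hmove e a) (hmove a e)
    exact (h1.trans (ih hN)).mono (by simp [add_comm])

/-- The target is built from the left: each operand is brought to the front of the unsorted part,
behind the finished prefix `b`. -/
theorem reach_perm {b l l' : List (Fin n)} {c : List (Operator k)} (hl : l.Perm l')
    (h : IsNPE (flat (b ++ l) c)) :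
    Reach (l.length ^ 2) (flat (b ++ l) c) (flat (b ++ l') c) := by
  induction l' generalizing b l with
  | nil =>
    obtain rfl := hl.eq_nil
    exact Reach.refl h
  | cons a l' ih =>
    obtain ⟨x, y, rfl⟩ := List.append_of_mem (hl.mem_iff.2 (List.mem_cons_self (a := a)))
    have hxy : (x ++ y).Perm l' := (List.perm_cons a).1 (List.perm_middle.symm.trans hl)
    have h1 := reach_move_to_front h
    have e : ∀ t : List (Fin n), b ++ a :: t = (b ++ [a]) ++ t := by simp
    rw [e] at h1
    have h2 := ih hxy h1.right
    rw [e]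
    refine (h1.trans h2).mono ?_
    simp only [List.length_append, List.length_cons]
    rw [show (x.length + (y.length + 1)) ^ 2 =
      (x.length + y.length) ^ 2 + 2 * (x.length + y.length) + 1 by ring]
    omega

/-! ### Connecting any two expressions -/

theorem exists_isNPE_flat (hk : 2 ≤ k) (hn : 1 ≤ n) : ∃ d : List (Operator k),
    IsAlternating d ∧ IsNPE (flat (List.finRange n) d) := by
  obtain ⟨d, hd, hlen, -⟩ := exists_alternating hk (n - 1) []
  refine ⟨d, hd, (isNPE_flat_iff _ _).2 ⟨.refl _, ?_, hd.isChain⟩⟩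
  rw [weight_of_slicing hd.1]
  omega

theorem reach_flat {w : List (Token n k)} {d : List (Operator k)} (hd : IsAlternating d)
    (hN : IsNPE (flat (List.finRange n) d)) (h : IsNPE w) :
    Reach (2 * n ^ 2 + 2 * n + n ^ 2 + 1) w (flat (List.finRange n) d) := by
  obtain ⟨l, c, h1⟩ := exists_reach_flat h
  obtain ⟨d', hd', h2⟩ := exists_reach_alternating h1.right
  have hp := (isNPE_flat_iff _ _).1 h2.right
  have h3 := reach_perm (b := []) hp.1 h2.right
  have h4 : Reach 1 (flat (List.finRange n) ([] ++ d')) (flat (List.finRange n) ([] ++ d)) := by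
    refine reach_alternating h3.right hd' hd ?_ (by simp)
    have := ((isNPE_flat_iff _ _).1 hN).2.1
    have := hp.2.1
    rw [weight_of_slicing hd'.1] at this
    rw [weight_of_slicing hd.1] at *
    omega
  rw [hp.1.length_eq, List.length_finRange] at h3
  exact (((h1.trans h2).trans h3).trans h4)

theorem edist_reversibleGraph_le (hk : 2 ≤ k) (hn : 1 ≤ n) (α β : NPE n k) :
    (reversibleGraph n k).edist α β ≤ ((12 * n ^ 2 : ℕ) : ℕ∞) := by
  obtain ⟨d, hd, hN⟩ := exists_isNPE_flat hk hn
  -- Two routes of length `3 * n ^ 2 + 2 * n + 1`, each at most `6 * n ^ 2` since `1 ≤ n`.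
  obtain ⟨_, _, h⟩ := ((reach_flat hd hN α.2).trans (reach_flat hd hN β.2).symm).mono
    (m' := 12 * n ^ 2) (by nlinarith)
  exact h

theorem reversibleGraph_le : reversibleGraph n k ≤ neighbourhoodGraph n k :=
  fun _ _ h => (SimpleGraph.fromRel_adj _ _ _).2 ⟨h.1, Or.inl h.2.1⟩

end HFO

theorem mainTheorem11 :
    ∃ C : ℕ, ∀ k n : ℕ, 2 ≤ k → 1 ≤ n →
      (HFO.neighbourhoodGraph n k).Connected ∧
      (HFO.neighbourhoodGraph n k).ediam ≤ ((C * n ^ 2 : ℕ) : ℕ∞) ∧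
      ∀ α β : HFO.NPE n k, ∃ ℓ : ℕ, ℓ ≤ C * n ^ 2 ∧
        ∃ p : ℕ → HFO.NPE n k, p 0 = α ∧ p ℓ = β ∧
          ∀ i < ℓ, HFO.Neighbour (p i) (p (i + 1)) := by
  refine ⟨12, fun k n hk hn => ?_⟩
  have hdist := HFO.edist_reversibleGraph_le hk hn
  have hdiam : (HFO.neighbourhoodGraph n k).ediam ≤ ((12 * n ^ 2 : ℕ) : ℕ∞) :=
    SimpleGraph.ediam_le_of_edist_le fun α β =>
      (SimpleGraph.edist_anti HFO.reversibleGraph_le).trans (hdist α β)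
  have : Nonempty (HFO.NPE n k) := by
    obtain ⟨d, -, hd⟩ := HFO.exists_isNPE_flat hk hn
    exact ⟨⟨_, hd⟩⟩
  refine ⟨SimpleGraph.connected_of_ediam_ne_top (ne_top_of_le_ne_top (ENat.natCast_ne_top _) hdiam),
    hdiam, fun α β => ?_⟩
  -- The walk is taken in `reversibleGraph`, since an edge of `neighbourhoodGraph` does not tell in
  -- which direction the move goes.
  obtain ⟨q, hq⟩ := SimpleGraph.exists_walk_of_edist_ne_top
    (ne_top_of_le_ne_top (ENat.natCast_ne_top _) (hdist α β))
  refine ⟨q.length, ?_, q.getVert, q.getVert_zero, q.getVert_length,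
    fun i hi => (q.adj_getVert_succ hi).2.1⟩
  exact_mod_cast hq.trans_le (hdist α β)
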